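/- Let $N\ge 2$ and let $\mathbf h_1,\mathbf h_2\in\mathbb C^N$, $h_3\in\mathbb C$ be random channels whose $2N+1$ entries are mutually independent $\mathcal{CN}(0,1)$ random variables (circularly symmetric complex Gaussian, i.e. with independent real and imaginary parts of law $\mathcal N(0,\tfrac12)$). Let $\eta,\rho,d_1,d_2,d_3,\gamma_{\sf th}>0$, $0<\tau<1$, $\alpha\in\mathbb R$, and put $$a_1=\frac{2\eta\tau\rho}{(1-\tau)d_1^{2\alpha}},\qquad b_1=\frac{2\eta\tau\rho}{(1-\tau)d_1^{\alpha}d_3^{\alpha}},\qquad c_1=\frac{2\eta\tau\rho}{(1-\tau)d_2^{2\alpha}}.$$ For a beamforming vector $\mathbf w\in\mathbb C^N$ the end-to-end signal-to-noise ratio is $$\gamma(\mathbf w)=a_1|\mathbf h_1^T\mathbf w|^2\|\mathbf h_1\|^2+\frac{b_1c_1\,|\mathbf h_1^T\mathbf w|^2|\mathbf h_2^T\mathbf w|^2|h_3|^2\|\mathbf h_2\|^2}{b_1|\mathbf h_1^T\mathbf w|^2|h_3|^2+c_1|\mathbf h_2^T\mathbf w|^2\|\mathbf h_2\|^2+1},$$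 where $\mathbf h^T$ is the transpose without conjugation and $\|\cdot\|$ is the Euclidean norm. Let $\gamma_{\sf m}=\gamma(\mathbf w)$ for $\mathbf w=\mathbf h_1^*/\|\mathbf h_1\|$, where $\mathbf h_1^*$ is the entrywise complex conjugate of $\mathbf h_1$. Then $$P(\gamma_{\sf m}<\gamma_{\sf th})=\int_0^{\sqrt{\gamma_{\sf th}/a_1}}\left(1-e^{\frac{a_1}{b_1}y-\frac{\gamma_{\sf th}}{b_1y}}\right)\frac{y^{N-1}}{\Gamma(N)}e^{-y}\,dy+\int_0^{\sqrt{\gamma_{\sf th}/a_1}}\left(\int_{\frac{\gamma_{\sf th}-a_1y^2}{b_1y}}^{\infty}F\bigl(\chi(y,\mu)\bigr)e^{-\mu}\,d\mu\right)\frac{y^{N-1}e^{-y}}{\Gamma(N)}\,dy,$$ where $$\chi(y,\mu)=\frac{(b_1y\mu+1)(\gamma_{\sf th}-a_1y^2)}{b_1c_1y\mu+a_1c_1y^2-\gamma_{\sf th}c_1},\qquad F(x)=1-2\sum_{m=0}^{N-1}\sum_{i=0}^{N-2}\binom{N-2}{i}\frac{(-1)^i(N-1)}{m!}\,x^{i+1}\,\Gamma\bigl(m-2i-2,\sqrt{x}\bigr)\quad(x>0),$$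 and $\Gamma(s,x)=\int_x^\infty t^{s-1}e^{-t}\,dt$ for $s\in\mathbb R$, $x>0$. The single integral, the inner integral for every $0<y<\sqrt{\gamma_{\sf th}/a_1}$, and the outer integral all converge absolutely. -/

import Mathlib

open MeasureTheory ProbabilityTheory

/-- The circularly symmetric complex Gaussian law `CN(0,1)`: real and imaginary part are
independent, each `N(0, 1/2)`. -/
noncomputable def stdComplexGaussian : Measure ℂ :=
  ((gaussianReal 0 (1 / 2)).prod (gaussianReal 0 (1 / 2))).map
    (fun p : ℝ × ℝ => (⟨p.1, p.2⟩ : ℂ))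

/-- The block Rayleigh fading model: the entries of the two channel vectors `h₁`, `h₂` and the
scalar channel `h₃` are `2 N + 1` mutually independent `CN(0,1)` random variables. -/
structure RayleighFading {Ω : Type*} [MeasurableSpace Ω] (P : Measure Ω) {N : ℕ}
    (h₁ h₂ : Ω → EuclideanSpace ℂ (Fin N)) (h₃ : Ω → ℂ) : Prop where
  law₁ : ∀ i, HasLaw (fun ω => h₁ ω i) stdComplexGaussian P
  law₂ : ∀ i, HasLaw (fun ω => h₂ ω i) stdComplexGaussian P
  law₃ : HasLaw h₃ stdComplexGaussian P
  indep : iIndepFun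
    (Sum.elim (fun i ω => h₁ ω i) (Sum.elim (fun i ω => h₂ ω i) (fun _ ω => h₃ ω)) :
      Fin N ⊕ Fin N ⊕ Unit → Ω → ℂ) P

/-- The bilinear product `hᵀ w` (no conjugation). -/
noncomputable def transposeMul {N : ℕ} (h w : EuclideanSpace ℂ (Fin N)) : ℂ :=
  ∑ i, h i * w i

/-- The beamforming vector `h^* / ‖h‖`, with `h^*` the entrywise complex conjugate. -/
noncomputable def userBeam {N : ℕ} (h : EuclideanSpace ℂ (Fin N)) : EuclideanSpace ℂ (Fin N) :=
  WithLp.toLp 2 (fun i => starRingEnd ℂ (h i) / (‖h‖ : ℂ))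

/-- The effective end-to-end signal to noise ratio after maximal ratio combining of the direct
link and the amplify-and-forward relay link, for the energy beamforming vector `w`. -/
noncomputable def effectiveSNR (η τ ρ α d₁ d₂ d₃ : ℝ) {N : ℕ}
    (h₁ h₂ : EuclideanSpace ℂ (Fin N)) (h₃ : ℂ) (w : EuclideanSpace ℂ (Fin N)) : ℝ :=
  2 * η * τ * ρ * ‖transposeMul h₁ w‖ ^ 2 * ‖h₁‖ ^ 2 / ((1 - τ) * d₁ ^ (2 * α)) +
    (4 * η ^ 2 * τ ^ 2 * ρ ^ 2 * ‖transposeMul h₁ w‖ ^ 2 * ‖transposeMul h₂ w‖ ^ 2 *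
        ‖h₃‖ ^ 2 * ‖h₂‖ ^ 2 / ((1 - τ) ^ 2 * d₁ ^ α * d₂ ^ (2 * α) * d₃ ^ α)) /
      (2 * η * τ * ρ * ‖transposeMul h₁ w‖ ^ 2 * ‖h₃‖ ^ 2 / ((1 - τ) * d₁ ^ α * d₃ ^ α) +
        2 * η * τ * ρ * ‖transposeMul h₂ w‖ ^ 2 * ‖h₂‖ ^ 2 / ((1 - τ) * d₂ ^ (2 * α)) + 1)

/-- The upper incomplete gamma function `Γ(s, x) = ∫ₓ^∞ t^(s-1) e^(-t) dt`, used for `x > 0`,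
where the integral converges for every real `s`. -/
noncomputable def upperGamma (s x : ℝ) : ℝ :=
  ∫ t in Set.Ioi x, t ^ (s - 1) * Real.exp (-t)

/-- The finite sum
`1 - 2 ∑_{m=0}^{N-1} ∑_{i=0}^{N-2} C(N-2,i) (-1)^i (N-1) / m! x^(i+1) Γ(m-2i-2, √x)`. -/
noncomputable def gammaSum (N : ℕ) (x : ℝ) : ℝ :=
  1 - 2 * ∑ m ∈ Finset.range N, ∑ i ∈ Finset.range (N - 1),
    ((N - 2).choose i : ℝ) * ((-1) ^ i * ((N : ℝ) - 1) / (m.factorial : ℝ)) * x ^ (i + 1) *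
      upperGamma ((m : ℝ) - 2 * (i : ℝ) - 2) (Real.sqrt x)

/-- The quantity `χ(y, μ)`. -/
noncomputable def chiArg (a₁ b₁ c₁ γth y μ : ℝ) : ℝ :=
  (b₁ * y * μ + 1) * (γth - a₁ * y ^ 2) / (b₁ * c₁ * y * μ + a₁ * c₁ * y ^ 2 - γth * c₁)

/-- The integrand of the single integral. -/
noncomputable def singleIntegrand (N : ℕ) (a₁ b₁ γth y : ℝ) : ℝ :=
  (1 - Real.exp (a₁ / b₁ * y - γth / (b₁ * y))) * (y ^ (N - 1) / Real.Gamma N) * Real.exp (-y)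

/-- The integrand, in `μ`, of the inner integral of the double integral. -/
noncomputable def innerIntegrand (N : ℕ) (a₁ b₁ c₁ γth y μ : ℝ) : ℝ :=
  gammaSum N (chiArg a₁ b₁ c₁ γth y μ) * Real.exp (-μ)

/-- The integrand, in `y`, of the outer integral of the double integral. -/
noncomputable def outerIntegrand (N : ℕ) (a₁ b₁ c₁ γth y : ℝ) : ℝ :=
  (∫ μ in Set.Ioi ((γth - a₁ * y ^ 2) / (b₁ * y)), innerIntegrand N a₁ b₁ c₁ γth y μ) *
    (y ^ (N - 1) * Real.exp (-y) / Real.Gamma N)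

/-!
The outage probability is computed by conditioning on `y = ‖h₁‖²` and `z = |h₃|²`.

For the beam `w = h₁* / ‖h₁‖` one has `|h₁ᵀ w|² = ‖h₁‖²`, so the signal-to-noise ratio depends on the
channels only through `y`, `z` and `x = |h₂ᵀ w|² ‖h₂‖²`; in these variables it is `scalarSNR`. For
fixed `y` and `z`, the event `scalarSNR < γ` is impossible when `γ ≤ a y²`, certain when
`b y z ≤ γ - a y²`, and otherwise equivalent to `x < χ(y, z)` (`scalarSNR_lt_iff`). The second regime
gives the single integral of the formula and the third one the double integral.

It remains to know three laws. Squared moduli of `CN(0,1)` variables are exponential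
(`hasLaw_norm_sq_stdComplexGaussian`, by polar coordinates), and sums of independent ones have a
Gamma law (`hasLaw_sum_norm_sq`, by `gammaMeasure_one_conv_gammaMeasure`). The law of `h₂` is
invariant under unitary maps, because its characteristic function depends only on the norm
(`measurePreserving_stdComplexGaussianVec`); hence `w`, which is a unit vector independent of `h₂`,
can be replaced by a basis vector, and `x` has the law of `U (U + V)` with `U` exponential and `V`
an independent Gamma variable. Integrating over `U` first, with `s = U + V` fixed, gives
`P(U (U + V) ≥ x)` as the integral of `exp (-s) (s - x / s) ^ (N - 1) / (N - 1)!` over `s > √x`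
(`stdComplexGaussianVec_le_transposeMul`), and one integration by parts turns this into the double
sum of incomplete gamma functions (`gammaSum_eq_one_sub_integral`).

Since `gammaSum` is thereby a distribution function on `(0, ∞)`, the conditional outage probability
`condOutage` is measurable with values in `[0, 1]`, hence integrable for the product of two Gamma
laws, and this gives the integrability of the inner and outer integrands. The integrand of the
single integral is dominated by a Gamma density.
-/

/-! ### Gamma laws with integer shape -/

theorem gammaMeasure_nat_eq_withDensity (n : ℕ) :
    gammaMeasure (n + 1) 1 = (volume.restrict (Set.Ioi 0)).withDensity
      (fun t => ENNReal.ofReal (t ^ n / n.factorial * Real.exp (-t))) := by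
  rw [← withDensity_indicator measurableSet_Ioi, gammaMeasure]
  refine withDensity_congr_ae ?_
  filter_upwards [Measure.ae_ne volume (0 : ℝ)] with t ht
  rcases lt_or_gt_of_ne ht with h | h
  · rw [gammaPDF_of_neg h, Set.indicator_of_notMem (by simpa using h.le)]
  · rw [gammaPDF_of_nonneg h.le, Set.indicator_of_mem (by simpa using h)]
    congr 1
    rw [Real.Gamma_nat_eq_factorial, add_sub_cancel_right, Real.rpow_natCast]
    simp
    ring

theorem lintegral_gammaMeasure_nat (n : ℕ) {f : ℝ → ENNReal} (hf : Measurable f) :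
    ∫⁻ t, f t ∂gammaMeasure (n + 1) 1 =
      ∫⁻ t in Set.Ioi 0, ENNReal.ofReal (t ^ n / n.factorial * Real.exp (-t)) * f t := by
  rw [gammaMeasure_nat_eq_withDensity, lintegral_withDensity_eq_lintegral_mul _ (by fun_prop) hf]
  rfl

theorem integral_gammaMeasure_nat (n : ℕ) (f : ℝ → ℝ) :
    ∫ t, f t ∂gammaMeasure (n + 1) 1 =
      ∫ t in Set.Ioi 0, t ^ n / n.factorial * Real.exp (-t) * f t := by
  rw [gammaMeasure_nat_eq_withDensity, integral_withDensity_eq_integral_toReal_smul (by fun_prop)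
    (by simp)]
  refine setIntegral_congr_fun measurableSet_Ioi fun t (ht : 0 < t) => ?_
  simp only [smul_eq_mul]
  rw [ENNReal.toReal_ofReal (by positivity)]

theorem integrable_gammaMeasure_nat_iff (n : ℕ) (f : ℝ → ℝ) :
    Integrable f (gammaMeasure (n + 1) 1) ↔
      IntegrableOn (fun t => t ^ n / n.factorial * Real.exp (-t) * f t) (Set.Ioi 0) := by
  rw [gammaMeasure_nat_eq_withDensity, integrable_withDensity_iff_integrable_smul' (by fun_prop)
    (by simp)]
  refine integrable_congr ?_
  filter_upwards [ae_restrict_mem measurableSet_Ioi] with t (ht : 0 < t)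
  rw [ENNReal.toReal_ofReal (by positivity), smul_eq_mul]

instance isProbabilityMeasure_gammaMeasure_nat (n : ℕ) :
    IsProbabilityMeasure (gammaMeasure (n + 1) 1) :=
  isProbabilityMeasure_gammaMeasure (by positivity) one_pos

instance isProbabilityMeasure_gammaMeasure_one : IsProbabilityMeasure (gammaMeasure 1 1) :=
  isProbabilityMeasure_gammaMeasure one_pos one_pos

/-- The joint law of `(U, U + V)` for independent `U ∼ Γ(1)` and `V ∼ Γ(n + 1)`: the sum `s` is
integrated last, and `u` ranges over `(0, s)`. -/
theorem lintegral_lintegral_gammaMeasure_add (n : ℕ) {f : ℝ → ℝ → ENNReal}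
    (hf : Measurable (Function.uncurry f)) :
    ∫⁻ u, ∫⁻ v, f u (u + v) ∂gammaMeasure (n + 1) 1 ∂gammaMeasure 1 1 =
      ∫⁻ s in Set.Ioi 0, ENNReal.ofReal (Real.exp (-s)) *
        ∫⁻ u in Set.Ioo 0 s, ENNReal.ofReal ((s - u) ^ n / n.factorial) * f u s := by
  have hf' : Measurable fun p : ℝ × ℝ => f p.1 p.2 := hf
  have h1 : Measurable fun u => ∫⁻ v, f u (u + v) ∂gammaMeasure (n + 1) 1 := by
    refine Measurable.lintegral_prod_right' (f := fun p : ℝ × ℝ => f p.1 (p.1 + p.2)) ?_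
    exact hf'.comp (measurable_fst.prodMk (measurable_fst.add measurable_snd))
  have h0 := lintegral_gammaMeasure_nat 0 h1
  simp only [Nat.cast_zero, zero_add, pow_zero, Nat.factorial_zero, Nat.cast_one, div_one,
    one_mul] at h0
  rw [h0]
  -- both sides equal the integral of the same function over `0 < u < s`
  let F : ℝ → ℝ → ENNReal := fun u s =>
    {p : ℝ × ℝ | 0 < p.1 ∧ p.1 < p.2}.indicator (fun p => ENNReal.ofReal (Real.exp (-p.2)) *
      (ENNReal.ofReal ((p.2 - p.1) ^ n / n.factorial) * f p.1 p.2)) (u, s)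
  have hS : MeasurableSet {p : ℝ × ℝ | 0 < p.1 ∧ p.1 < p.2} :=
    (measurableSet_lt measurable_const measurable_fst).inter
      (measurableSet_lt measurable_fst measurable_snd)
  have hF : Measurable (Function.uncurry F) := by
    refine Measurable.indicator ?_ hS
    fun_prop
  trans ∫⁻ u, ∫⁻ s, F u s
  · rw [← lintegral_indicator measurableSet_Ioi]
    refine lintegral_congr fun u => ?_
    by_cases hu : 0 < u
    · rw [Set.indicator_of_mem (by simpa using hu), lintegral_gammaMeasure_nat n (by fun_prop),
        ← lintegral_const_mul _ (by fun_prop), ← lintegral_indicator measurableSet_Ioi,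
        ← lintegral_sub_right_eq_self _ u]
      refine lintegral_congr fun s => ?_
      by_cases hs : u < s
      · rw [Set.indicator_of_mem (by simpa using hs)]
        simp only [F]
        rw [Set.indicator_of_mem (by simp [hu, hs]), add_sub_cancel, ← mul_assoc, ← mul_assoc,
          ← ENNReal.ofReal_mul (by positivity), ← ENNReal.ofReal_mul (by positivity)]
        congr 2
        rw [show -s = -u + -(s - u) by ring, Real.exp_add]
        ring
      · rw [Set.indicator_of_notMem (by simpa using hs)]
        simp only [F]
        rw [Set.indicator_of_notMem (by simp [hs])]
    · rw [Set.indicator_of_notMem (by simpa using hu)]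
      symm
      refine (lintegral_congr fun s => ?_).trans lintegral_zero
      simp [F, hu]
  · rw [lintegral_lintegral_swap hF.aemeasurable, ← lintegral_indicator measurableSet_Ioi]
    refine lintegral_congr fun s => ?_
    by_cases hs : 0 < s
    · rw [Set.indicator_of_mem (by simpa using hs), ← lintegral_const_mul _ (by fun_prop),
        ← lintegral_indicator measurableSet_Ioo]
      rfl
    · rw [Set.indicator_of_notMem (by simpa using hs)]
      refine (lintegral_congr fun u => ?_).trans lintegral_zero
      simp only [F]
      rw [Set.indicator_of_notMem]
      simp only [Set.mem_ofPred_eq, not_and]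
      intro _ _
      linarith

theorem setLIntegral_sub_pow_div_factorial (n : ℕ) {a s : ℝ} (has : a ≤ s) :
    ∫⁻ u in Set.Ioo a s, ENNReal.ofReal ((s - u) ^ n / n.factorial) =
      ENNReal.ofReal ((s - a) ^ (n + 1) / (n + 1).factorial) := by
  rw [← ofReal_integral_eq_lintegral_ofReal, ← integral_Ioc_eq_integral_Ioo,
    ← intervalIntegral.integral_of_le has]
  · congr 1
    rw [intervalIntegral.integral_div,
      intervalIntegral.integral_comp_sub_left (fun x => x ^ n) s, integral_pow, sub_self,
      Nat.factorial_succ]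
    push_cast
    rw [zero_pow (by omega), sub_zero, div_div]
  · exact (Continuous.integrableOn_Icc (by fun_prop)).mono_set Set.Ioo_subset_Icc_self
  · filter_upwards [ae_restrict_mem measurableSet_Ioo] with u hu
    have : 0 ≤ s - u := by linarith [hu.2]
    simp only [Pi.zero_apply]
    positivity

theorem gammaMeasure_one_conv_gammaMeasure (n : ℕ) :
    (gammaMeasure 1 1) ∗ (gammaMeasure (n + 1) 1) = gammaMeasure ((n + 1 : ℕ) + 1) 1 := by
  refine Measure.ext_of_lintegral _ fun f hf => ?_
  rw [Measure.lintegral_conv hf,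
    lintegral_lintegral_gammaMeasure_add n (f := fun _ s => f s) (by fun_prop),
    lintegral_gammaMeasure_nat _ hf]
  refine setLIntegral_congr_fun measurableSet_Ioi fun s (hs : 0 < s) => ?_
  rw [lintegral_mul_const _ (by fun_prop), setLIntegral_sub_pow_div_factorial n hs.le, sub_zero,
    ← mul_assoc, ← ENNReal.ofReal_mul (by positivity), mul_comm (Real.exp _)]

/-! ### The complex Gaussian law and its unitary invariance -/

theorem measurable_complex_mk : Measurable fun p : ℝ × ℝ => (⟨p.1, p.2⟩ : ℂ) :=
  Complex.measurableEquivRealProd.symm.measurable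

instance isProbabilityMeasure_stdComplexGaussian : IsProbabilityMeasure stdComplexGaussian :=
  Measure.isProbabilityMeasure_map measurable_complex_mk.aemeasurable

theorem hasLaw_norm_sq_stdComplexGaussian :
    HasLaw (fun z : ℂ => ‖z‖ ^ 2) (gammaMeasure 1 1) stdComplexGaussian := by
  refine ⟨by fun_prop, Measure.ext_of_lintegral _ fun f hf => ?_⟩
  have hv : (1 / 2 : NNReal) ≠ 0 := by norm_num
  have h0 := lintegral_gammaMeasure_nat 0 hf
  simp only [Nat.cast_zero, zero_add, pow_zero, Nat.factorial_zero, Nat.cast_one, div_one,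
    one_mul] at h0
  have hpdf : ∀ x y : ℝ, gaussianPDF 0 (1 / 2) x * gaussianPDF 0 (1 / 2) y =
      ENNReal.ofReal (Real.pi⁻¹ * Real.exp (-(x ^ 2 + y ^ 2))) := by
    intro x y
    rw [gaussianPDF, gaussianPDF, ← ENNReal.ofReal_mul (gaussianPDFReal_nonneg _ _ _),
      gaussianPDFReal, gaussianPDFReal]
    congr 1
    have h2 : (2 : ℝ) * Real.pi * ((1 / 2 : NNReal) : ℝ) = Real.pi := by
      push_cast; ring
    have h3 : (2 : ℝ) * ((1 / 2 : NNReal) : ℝ) = 1 := by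
      push_cast; ring
    rw [h2, h3, show -(x ^ 2 + y ^ 2) = -(x - 0) ^ 2 / 1 + -(y - 0) ^ 2 / 1 by ring, Real.exp_add]
    have := Real.mul_self_sqrt Real.pi_pos.le
    calc _ = (√Real.pi * √Real.pi)⁻¹ * (Real.exp (-(x - 0) ^ 2 / 1) *
          Real.exp (-(y - 0) ^ 2 / 1)) := by rw [mul_inv]; ring
      _ = _ := by rw [this]
  have hnorm : ∀ p : ℝ × ℝ, ‖(⟨p.1, p.2⟩ : ℂ)‖ ^ 2 = p.1 ^ 2 + p.2 ^ 2 := by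
    intro p
    rw [← Complex.normSq_eq_norm_sq, Complex.normSq_mk]
    ring
  have hm : Measurable fun z : ℂ => f (‖z‖ ^ 2) := by fun_prop
  have hm' : Measurable fun p : ℝ × ℝ => f (p.1 ^ 2 + p.2 ^ 2) := by fun_prop
  rw [lintegral_map hf (by fun_prop), stdComplexGaussian, lintegral_map hm measurable_complex_mk]
  simp only [hnorm]
  rw [gaussianReal_of_var_ne_zero _ hv,
    prod_withDensity (measurable_gaussianPDF _ _) (measurable_gaussianPDF _ _),
    lintegral_withDensity_eq_lintegral_mul _ (by fun_prop) hm', ← Measure.volume_eq_prod,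
    ← lintegral_comp_polarCoord_symm, h0]
  simp only [Pi.mul_apply, hpdf, smul_eq_mul]
  -- in polar coordinates the integrand depends on the radius only
  have hpol : ∀ p : ℝ × ℝ, (polarCoord.symm p).1 ^ 2 + (polarCoord.symm p).2 ^ 2 = p.1 ^ 2 := by
    intro p
    simp only [polarCoord_symm_apply]
    linear_combination p.1 ^ 2 * Real.sin_sq_add_cos_sq p.2
  simp only [hpol, polarCoord_target]
  rw [Measure.volume_eq_prod, ← Measure.prod_restrict, lintegral_prod _ (by fun_prop)]
  simp only [lintegral_const, Measure.restrict_apply_univ, Real.volume_Ioo]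
  have himg : (fun r : ℝ => r ^ 2) '' Set.Ioi 0 = Set.Ioi 0 := by
    ext t
    constructor
    · rintro ⟨r, hr, rfl⟩
      exact pow_pos (Set.mem_Ioi.mp hr) 2
    · intro ht
      exact ⟨√t, Real.sqrt_pos.2 ht, Real.sq_sqrt (Set.mem_Ioi.mp ht).le⟩
  -- substitute `t = r ^ 2` on the right-hand side
  conv_rhs => rw [← himg]
  rw [lintegral_image_eq_lintegral_abs_deriv_mul measurableSet_Ioi (f' := fun r => 2 * r)
    (fun r _ => by simpa using (hasDerivAt_pow 2 r).hasDerivWithinAt)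
    (fun r hr s hs h => (pow_left_inj₀ (Set.mem_Ioi.mp hr).le (Set.mem_Ioi.mp hs).le
      two_ne_zero).1 h)]
  refine setLIntegral_congr_fun measurableSet_Ioi fun r (hr : 0 < r) => ?_
  have hpi := Real.pi_pos
  rw [abs_of_pos (by positivity), mul_comm, ← mul_assoc, ← mul_assoc, ← mul_assoc,
    ← ENNReal.ofReal_mul (by linarith), ← ENNReal.ofReal_mul (by nlinarith),
    ← ENNReal.ofReal_mul (by positivity)]
  congr 2
  field_simp
  ring

/-- Here `ℂ` is the Euclidean plane, with the real inner product. -/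
theorem charFun_stdComplexGaussian (t : ℂ) :
    charFun stdComplexGaussian t = Complex.exp (-(‖t‖ ^ 2 / 4 : ℝ)) := by
  have hG := fun s : ℝ => charFun_gaussianReal (μ := 0) (v := 1 / 2) s
  simp only [charFun_apply_real] at hG
  rw [charFun_apply, stdComplexGaussian, integral_map measurable_complex_mk.aemeasurable
    (Measurable.aestronglyMeasurable (by fun_prop))]
  have : ∀ p : ℝ × ℝ, Complex.exp ((inner ℝ (⟨p.1, p.2⟩ : ℂ) t : ℝ) * Complex.I) =
      Complex.exp (t.re * p.1 * Complex.I) * Complex.exp (t.im * p.2 * Complex.I) := by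
    intro p
    rw [← Complex.exp_add, Complex.inner]
    congr 1
    simp
    ring
  simp only [this]
  rw [integral_prod_mul (fun x : ℝ => Complex.exp (t.re * x * Complex.I))
    (fun x : ℝ => Complex.exp (t.im * x * Complex.I)), hG, hG, ← Complex.exp_add,
    ← Complex.normSq_eq_norm_sq, Complex.normSq_apply]
  congr 1
  push_cast
  ring

/-- The law of a vector in `ℂ ^ N` with independent `CN(0,1)` entries. -/
noncomputable def stdComplexGaussianVec (N : ℕ) : Measure (EuclideanSpace ℂ (Fin N)) :=
  (Measure.pi fun _ : Fin N => stdComplexGaussian).map (WithLp.toLp 2)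

instance isProbabilityMeasure_stdComplexGaussianVec (N : ℕ) :
    IsProbabilityMeasure (stdComplexGaussianVec N) :=
  Measure.isProbabilityMeasure_map (by fun_prop)

theorem charFun_stdComplexGaussianVec (N : ℕ) (t : EuclideanSpace ℂ (Fin N)) :
    charFun (stdComplexGaussianVec N) t = Complex.exp (-(‖t‖ ^ 2 / 4 : ℝ)) := by
  rw [stdComplexGaussianVec, charFun_pi]
  simp only [charFun_stdComplexGaussian]
  rw [← Complex.exp_sum, EuclideanSpace.norm_sq_eq]
  congr 1
  push_cast
  rw [Finset.sum_neg_distrib, Finset.sum_div]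

/-- The law of a standard complex Gaussian vector is invariant under unitary maps, since its
characteristic function depends only on the norm. -/
theorem measurePreserving_stdComplexGaussianVec {N : ℕ}
    (L : EuclideanSpace ℂ (Fin N) ≃ₗᵢ[ℂ] EuclideanSpace ℂ (Fin N)) :
    MeasurePreserving L (stdComplexGaussianVec N) (stdComplexGaussianVec N) := by
  have hL : Measurable L := L.continuous.measurable
  refine ⟨hL, ?_⟩
  have := Measure.isProbabilityMeasure_map (μ := stdComplexGaussianVec N) hL.aemeasurable
  refine Measure.ext_of_charFun (funext fun t => ?_)
  -- `L` is complex linear, so its adjoint for the real inner product comes from polarization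
  have hinner : ∀ x, (inner ℝ (L x) t : ℝ) = inner ℝ x (L.symm t) := by
    intro x
    have h1 := real_inner_eq_norm_add_mul_self_sub_norm_mul_self_sub_norm_mul_self_div_two (L x) t
    have h2 := real_inner_eq_norm_add_mul_self_sub_norm_mul_self_sub_norm_mul_self_div_two x
      (L.symm t)
    have h3 : L x + t = L (x + L.symm t) := by simp
    rw [h1, h2, h3, L.norm_map, L.norm_map, L.symm.norm_map]
  rw [charFun_apply, integral_map hL.aemeasurable (Measurable.aestronglyMeasurable (by fun_prop))]
  simp only [hinner]
  rw [← charFun_apply, charFun_stdComplexGaussianVec, charFun_stdComplexGaussianVec,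
    L.symm.norm_map]

/-! ### The law of `|hᵀ w|² ‖h‖²` -/

theorem hasLaw_norm_sq_prod_of_hasLaw {n : ℕ} {ν : Measure ℝ}
    (h : HasLaw (fun z : Fin n → ℂ => ∑ i, ‖z i‖ ^ 2) ν
      (Measure.pi fun _ => stdComplexGaussian)) :
    HasLaw (fun z : Fin (n + 1) → ℂ => (‖z 0‖ ^ 2, ∑ i : Fin n, ‖z i.succ‖ ^ 2))
      ((gammaMeasure 1 1).prod ν) (Measure.pi fun _ => stdComplexGaussian) := by
  have hmp := measurePreserving_piFinSuccAbove (fun _ : Fin (n + 1) => stdComplexGaussian) 0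
  have hm1 : Measurable fun z : ℂ => ‖z‖ ^ 2 := by fun_prop
  have hm2 : Measurable fun z : Fin n → ℂ => ∑ i, ‖z i‖ ^ 2 := by fun_prop
  refine ⟨by fun_prop, ?_⟩
  have hcomp : (fun z : Fin (n + 1) → ℂ => (‖z 0‖ ^ 2, ∑ i : Fin n, ‖z i.succ‖ ^ 2)) =
      Prod.map (fun z : ℂ => ‖z‖ ^ 2) (fun z : Fin n → ℂ => ∑ i, ‖z i‖ ^ 2) ∘
        MeasurableEquiv.piFinSuccAbove (fun _ => ℂ) 0 := by
    ext z
    · rfl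
    · simp [MeasurableEquiv.piFinSuccAbove, Fin.tail, Prod.map]
  rw [hcomp, ← Measure.map_map (hm1.prodMap hm2) hmp.measurable, hmp.map_eq,
    ← Measure.map_prod_map _ _ hm1 hm2, h.map_eq, hasLaw_norm_sq_stdComplexGaussian.map_eq]

theorem hasLaw_sum_norm_sq (n : ℕ) :
    HasLaw (fun z : Fin (n + 1) → ℂ => ∑ i, ‖z i‖ ^ 2) (gammaMeasure (n + 1) 1)
      (Measure.pi fun _ => stdComplexGaussian) := by
  induction n with
  | zero =>
    have hmp := measurePreserving_funUnique stdComplexGaussian (Fin 1)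
    refine ⟨Measurable.aemeasurable (by fun_prop), ?_⟩
    have hm1 : Measurable fun z : ℂ => ‖z‖ ^ 2 := by fun_prop
    have hcomp : (fun z : Fin (0 + 1) → ℂ => ∑ i, ‖z i‖ ^ 2) =
        (fun z : ℂ => ‖z‖ ^ 2) ∘ MeasurableEquiv.funUnique (Fin 1) ℂ := by
      ext z
      simp [MeasurableEquiv.funUnique]
    have hmap : (Measure.pi fun _ : Fin (0 + 1) => stdComplexGaussian).map
        (MeasurableEquiv.funUnique (Fin 1) ℂ) = stdComplexGaussian := by
      convert hmp.map_eq
    rw [hcomp, ← Measure.map_map hm1 hmp.measurable, hmap,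
      hasLaw_norm_sq_stdComplexGaussian.map_eq]
    simp
  | succ n ih =>
    have h := hasLaw_norm_sq_prod_of_hasLaw ih
    refine ⟨Measurable.aemeasurable (by fun_prop), ?_⟩
    have hm : Measurable fun z : Fin (n + 1 + 1) → ℂ =>
      (‖z 0‖ ^ 2, ∑ i : Fin (n + 1), ‖z i.succ‖ ^ 2) := by fun_prop
    have hcomp : (fun z : Fin (n + 1 + 1) → ℂ => ∑ i, ‖z i‖ ^ 2) =
        (fun p : ℝ × ℝ => p.1 + p.2) ∘
          fun z => (‖z 0‖ ^ 2, ∑ i : Fin (n + 1), ‖z i.succ‖ ^ 2) := by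
      ext z
      simp [Fin.sum_univ_succ]
    rw [hcomp, ← Measure.map_map (by fun_prop) hm, h.map_eq, ← gammaMeasure_one_conv_gammaMeasure]
    rfl

theorem hasLaw_norm_sq_stdComplexGaussianVec (n : ℕ) :
    HasLaw (fun h : EuclideanSpace ℂ (Fin (n + 1)) => ‖h‖ ^ 2) (gammaMeasure (n + 1) 1)
      (stdComplexGaussianVec (n + 1)) := by
  refine ⟨by fun_prop, ?_⟩
  rw [stdComplexGaussianVec, Measure.map_map (by fun_prop) (by fun_prop),
    ← (hasLaw_sum_norm_sq n).map_eq]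
  congr 1
  ext z
  simp [EuclideanSpace.norm_sq_eq]

theorem measurable_transposeMul {N : ℕ} (w : EuclideanSpace ℂ (Fin N)) :
    Measurable fun h => transposeMul h w := by
  unfold transposeMul
  fun_prop

/-- By rotation invariance, `hᵀ w` can be replaced by the first entry of `h`. -/
theorem map_norm_sq_transposeMul_stdComplexGaussianVec {n : ℕ}
    {w : EuclideanSpace ℂ (Fin (n + 1))} (hw : ‖w‖ = 1) :
    (stdComplexGaussianVec (n + 1)).map (fun h => (‖transposeMul h w‖ ^ 2, ‖h‖ ^ 2)) =
      (stdComplexGaussianVec (n + 1)).map (fun h => (‖h 0‖ ^ 2, ‖h‖ ^ 2)) := by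
  set w' : EuclideanSpace ℂ (Fin (n + 1)) := WithLp.toLp 2 fun i => starRingEnd ℂ (w i) with hw'
  have hw1 : ‖w'‖ = 1 := by
    rw [← hw, EuclideanSpace.norm_eq, EuclideanSpace.norm_eq]
    simp [hw']
  -- complete the conjugate of `w` to an orthonormal basis; `hᵀ w` is then the first coordinate of `h`
  have horth : Orthonormal ℂ (({0} : Set (Fin (n + 1))).domRestrict fun _ => w') := by
    refine ⟨fun _ => hw1, fun i j hij => ?_⟩
    exact absurd (Subsingleton.elim i j) hij
  obtain ⟨b, hb⟩ := horth.exists_orthonormalBasis_extension_of_card_eq (by simp)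
  have hb0 : b 0 = w' := hb 0 rfl
  have hmp := measurePreserving_stdComplexGaussianVec b.repr
  have hm : Measurable fun h : EuclideanSpace ℂ (Fin (n + 1)) => (‖h 0‖ ^ 2, ‖h‖ ^ 2) := by
    fun_prop
  rw [← hmp.map_eq, Measure.map_map hm hmp.measurable, hmp.map_eq]
  congr 1
  ext h
  · have : b.repr h 0 = transposeMul h w := by
      rw [b.repr_apply_apply, hb0, transposeMul, PiLp.inner_apply]
      refine Finset.sum_congr rfl fun i _ => ?_
      simp [hw']
    simp [this]
  · simp

/-- For a given value `s` of `U + V`, the constraint `x ≤ U s` restricts `U` to `[x / s, s)`, which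
is nonempty exactly when `√x < s`. -/
theorem setLIntegral_sub_pow_mul_indicator (n : ℕ) {x s : ℝ} (hx : 0 < x) (hs : 0 < s) :
    ∫⁻ u in Set.Ioo 0 s, ENNReal.ofReal ((s - u) ^ n / n.factorial) *
        {u : ℝ | x ≤ u * s}.indicator 1 u =
      (Set.Ioi √x).indicator
        (fun s => ENNReal.ofReal ((s - x / s) ^ (n + 1) / (n + 1).factorial)) s := by
  have hm : MeasurableSet {u : ℝ | x ≤ u * s} :=
    measurableSet_le measurable_const (by fun_prop)
  have hind : ∀ u, ENNReal.ofReal ((s - u) ^ n / n.factorial) *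
      {u : ℝ | x ≤ u * s}.indicator 1 u = {u : ℝ | x ≤ u * s}.indicator
        (fun u => ENNReal.ofReal ((s - u) ^ n / n.factorial)) u := by
    intro u
    by_cases hu : u ∈ {u : ℝ | x ≤ u * s}
    · simp only [Set.indicator_of_mem hu, Pi.one_apply, mul_one]
    · simp only [Set.indicator_of_notMem hu, mul_zero]
  simp only [hind]
  rw [lintegral_indicator hm, Measure.restrict_restrict hm]
  have hpos : 0 < x / s := by positivity
  have hset : {u : ℝ | x ≤ u * s} ∩ Set.Ioo 0 s = Set.Ico (x / s) s := by
    ext u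
    simp only [Set.mem_inter_iff, Set.mem_ofPred_eq, Set.mem_Ioo, Set.mem_Ico, div_le_iff₀ hs]
    constructor
    · rintro ⟨h1, -, h2⟩
      exact ⟨h1, h2⟩
    · rintro ⟨h1, h2⟩
      exact ⟨h1, hpos.trans_le ((div_le_iff₀ hs).2 h1), h2⟩
  rw [hset, setLIntegral_congr Ioo_ae_eq_Ico.symm]
  by_cases h : √x < s
  · rw [Set.indicator_of_mem (by simpa using h), setLIntegral_sub_pow_div_factorial]
    rw [div_le_iff₀ hs]
    have := (Real.sqrt_lt' hs).1 h
    nlinarith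
  · rw [Set.indicator_of_notMem (by simpa using h), Set.Ioo_eq_empty]
    · simp
    · rw [not_lt, le_div_iff₀ hs]
      have := (Real.le_sqrt hs.le hx.le).1 (not_lt.1 h)
      nlinarith

/-- The tail of `|hᵀ w|² ‖h‖²` for a unit vector `w`: this variable has the law of `U (U + V)` with
`U ∼ Γ(1)` and `V ∼ Γ(n + 1)` independent. -/
theorem stdComplexGaussianVec_le_transposeMul (n : ℕ) {w : EuclideanSpace ℂ (Fin (n + 2))}
    (hw : ‖w‖ = 1) {x : ℝ} (hx : 0 < x) :
    stdComplexGaussianVec (n + 2) {h | x ≤ ‖transposeMul h w‖ ^ 2 * ‖h‖ ^ 2} =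
      ∫⁻ s in Set.Ioi √x, ENNReal.ofReal
        (Real.exp (-s) * ((s - x / s) ^ (n + 1) / (n + 1).factorial)) := by
  have hS : MeasurableSet {p : ℝ × ℝ | x ≤ p.1 * p.2} :=
    measurableSet_le measurable_const (by fun_prop)
  have hT : MeasurableSet {p : ℝ × ℝ | x ≤ p.1 * (p.1 + p.2)} :=
    measurableSet_le measurable_const (by fun_prop)
  have hlaw := hasLaw_norm_sq_prod_of_hasLaw (hasLaw_sum_norm_sq n)
  have hm : Measurable fun h : EuclideanSpace ℂ (Fin (n + 2)) => (‖h 0‖ ^ 2, ‖h‖ ^ 2) := by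
    fun_prop
  have hm' : Measurable fun h : EuclideanSpace ℂ (Fin (n + 2)) =>
      (‖transposeMul h w‖ ^ 2, ‖h‖ ^ 2) := by
    have := measurable_transposeMul w
    fun_prop
  have h1 : stdComplexGaussianVec (n + 2) {h | x ≤ ‖transposeMul h w‖ ^ 2 * ‖h‖ ^ 2} =
      stdComplexGaussianVec (n + 2) {h | x ≤ ‖h 0‖ ^ 2 * ‖h‖ ^ 2} := by
    have := congrArg (fun ν => ν {p : ℝ × ℝ | x ≤ p.1 * p.2})
      (map_norm_sq_transposeMul_stdComplexGaussianVec hw)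
    simp only [Measure.map_apply hm' hS, Measure.map_apply hm hS] at this
    exact this
  have hS' : MeasurableSet {h : EuclideanSpace ℂ (Fin (n + 2)) | x ≤ ‖h 0‖ ^ 2 * ‖h‖ ^ 2} := hm hS
  rw [stdComplexGaussianVec, Measure.map_apply (by fun_prop) hS', ← stdComplexGaussianVec] at h1
  have h2 := hlaw.measure_eq (p := fun p => x ≤ p.1 * (p.1 + p.2)) hT
  have hset : (WithLp.toLp 2 ⁻¹' {h : EuclideanSpace ℂ (Fin (n + 2)) |
      x ≤ ‖h 0‖ ^ 2 * ‖h‖ ^ 2} : Set (Fin (n + 2) → ℂ)) =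
      {z | x ≤ ‖z 0‖ ^ 2 * (‖z 0‖ ^ 2 + ∑ i : Fin (n + 1), ‖z i.succ‖ ^ 2)} := by
    ext z
    simp [EuclideanSpace.norm_sq_eq, Fin.sum_univ_succ]
  rw [hset, h2, Measure.prod_apply hT] at h1
  refine h1.trans ?_
  have hf : Measurable (Function.uncurry fun u s : ℝ =>
      ({u : ℝ | x ≤ u * s}.indicator 1 u : ENNReal)) := by
    change Measurable fun p : ℝ × ℝ => ({p : ℝ × ℝ | x ≤ p.1 * p.2}.indicator 1 p : ENNReal)
    exact measurable_one.indicator hS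
  have h3 := lintegral_lintegral_gammaMeasure_add n hf
  have h4 : ∀ u : ℝ, gammaMeasure (n + 1) 1
      (Prod.mk u ⁻¹' {p : ℝ × ℝ | x ≤ p.1 * (p.1 + p.2)}) =
      ∫⁻ v, {u : ℝ | x ≤ u * (u + v)}.indicator 1 u ∂gammaMeasure (n + 1) 1 := by
    intro u
    rw [← lintegral_indicator_one (measurable_prodMk_left hT)]
    rfl
  have h5 : ∀ u v : ℝ, ({u : ℝ | x ≤ u * (u + v)}.indicator 1 u : ENNReal) =
      {u' : ℝ | x ≤ u' * (u + v)}.indicator 1 u := fun u v => rfl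
  simp only [h4, h5]
  rw [h3]
  have h6 : ∀ s ∈ Set.Ioi (0 : ℝ), ENNReal.ofReal (Real.exp (-s)) *
      (∫⁻ u in Set.Ioo 0 s, ENNReal.ofReal ((s - u) ^ n / n.factorial) *
        {u : ℝ | x ≤ u * s}.indicator 1 u) = (Set.Ioi √x).indicator (fun s => ENNReal.ofReal
        (Real.exp (-s) * ((s - x / s) ^ (n + 1) / (n + 1).factorial))) s := by
    intro s hs
    rw [setLIntegral_sub_pow_mul_indicator n hx hs]
    by_cases h : s ∈ Set.Ioi √x
    · rw [Set.indicator_of_mem h, Set.indicator_of_mem h, ENNReal.ofReal_mul (Real.exp_pos _).le]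
    · rw [Set.indicator_of_notMem h, Set.indicator_of_notMem h, mul_zero]
  rw [setLIntegral_congr_fun measurableSet_Ioi h6, lintegral_indicator measurableSet_Ioi,
    Measure.restrict_restrict measurableSet_Ioi, Set.inter_eq_left.2]
  exact Set.Ioi_subset_Ioi (Real.sqrt_nonneg x)

/-! ### The finite sum of incomplete gamma functions -/

theorem integrableOn_Ioi_rpow_mul_exp_neg (a : ℝ) {c : ℝ} (hc : 0 < c) :
    IntegrableOn (fun t : ℝ => t ^ a * Real.exp (-t)) (Set.Ioi c) := by
  refine integrable_of_isBigO_exp_neg one_half_pos ?_ ?_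
  · refine ContinuousOn.mul (continuousOn_id.rpow_const fun t ht => Or.inl ?_) (by fun_prop)
    exact (hc.trans_le ht).ne'
  · simpa only [mul_comm] using (Real.Gamma_integrand_isLittleO a).isBigO

/-- The derivative telescopes: this sum is the tail function of the Gamma law of shape `k + 1`. -/
theorem hasDerivAt_sum_pow_div_factorial_mul_exp_neg (k : ℕ) (t : ℝ) :
    HasDerivAt (fun t : ℝ => ∑ m ∈ Finset.range (k + 1), t ^ m / m.factorial * Real.exp (-t))
      (-(t ^ k / k.factorial * Real.exp (-t))) t := by
  have hexp : HasDerivAt (fun t : ℝ => Real.exp (-t)) (-Real.exp (-t)) t := by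
    simpa using (hasDerivAt_neg t).exp
  induction k with
  | zero => simpa using hexp
  | succ k ih =>
    simp only [Finset.sum_range_succ _ (k + 1)]
    refine (ih.add (((hasDerivAt_pow (k + 1) t).div_const _).mul hexp)).congr_deriv ?_
    rw [Nat.factorial_succ]
    push_cast
    field_simp
    ring

theorem tendsto_sum_pow_div_factorial_mul_exp_neg (k : ℕ) :
    Filter.Tendsto
      (fun t : ℝ => ∑ m ∈ Finset.range k, t ^ m / m.factorial * Real.exp (-t))
      Filter.atTop (nhds 0) := by
  rw [← Finset.sum_const_zero (s := Finset.range k)]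
  refine tendsto_finsetSum _ fun m _ => ?_
  have := (Real.tendsto_pow_mul_exp_neg_atTop_nhds_zero m).div_const (m.factorial : ℝ)
  rw [zero_div] at this
  refine this.congr fun t => ?_
  ring

/-- Binomial expansion of the derivative of `(1 - x / t ^ 2) ^ (n + 1)`, multiplied by the tail
function of the Gamma law of shape `n + 2`, into integrands of incomplete gamma functions. -/
theorem mul_sum_eq_sum_rpow (n : ℕ) (x : ℝ) {t : ℝ} (ht : 0 < t) :
    (n + 1 : ℕ) * (1 - x / t ^ 2) ^ n * (2 * x / t ^ 3) *
        ∑ m ∈ Finset.range (n + 2), t ^ m / m.factorial * Real.exp (-t) =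
      ∑ m ∈ Finset.range (n + 2), ∑ i ∈ Finset.range (n + 1),
        2 * ((n.choose i : ℝ) * ((-1) ^ i * (((n + 2 : ℕ) : ℝ) - 1) / (m.factorial : ℝ)) *
          x ^ (i + 1)) * (t ^ (((m : ℝ) - 2 * (i : ℝ) - 2) - 1) * Real.exp (-t)) := by
  rw [Finset.mul_sum]
  refine Finset.sum_congr rfl fun m _ => ?_
  rw [sub_eq_neg_add, add_pow, Finset.mul_sum, Finset.sum_mul, Finset.sum_mul]
  refine Finset.sum_congr rfl fun i _ => ?_
  have hr : t ^ (((m : ℝ) - 2 * (i : ℝ) - 2) - 1) = t ^ m / (t ^ (2 * i) * t ^ 3) := by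
    rw [show (((m : ℝ) - 2 * (i : ℝ) - 2) - 1) = (m : ℝ) - ((2 * i + 3 : ℕ) : ℝ) by
      push_cast; ring, Real.rpow_sub ht, Real.rpow_natCast, Real.rpow_natCast, pow_add]
  rw [hr, one_pow, neg_pow, div_pow, ← pow_mul, pow_succ x i]
  push_cast
  have := ht.ne'
  field_simp
  ring

/-- Integration by parts turns the tail integral into the finite sum of incomplete gamma
functions. -/
theorem gammaSum_eq_one_sub_integral (n : ℕ) {x : ℝ} (hx : 0 < x) :
    gammaSum (n + 2) x =
      1 - ∫ s in Set.Ioi √x, Real.exp (-s) * ((s - x / s) ^ (n + 1) / (n + 1).factorial) := by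
  have hc : 0 < √x := Real.sqrt_pos.2 hx
  set Q : ℝ → ℝ := fun t => ∑ m ∈ Finset.range (n + 2), t ^ m / m.factorial * Real.exp (-t)
  set w' : ℝ → ℝ := fun t => (n + 1 : ℕ) * (1 - x / t ^ 2) ^ n * (2 * x / t ^ 3) with hw'
  have hint : ∀ m i : ℕ, IntegrableOn (fun t : ℝ =>
      2 * ((n.choose i : ℝ) * ((-1) ^ i * (((n + 2 : ℕ) : ℝ) - 1) / (m.factorial : ℝ)) *
          x ^ (i + 1)) * (t ^ (((m : ℝ) - 2 * (i : ℝ) - 2) - 1) * Real.exp (-t)))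
      (Set.Ioi √x) := fun m i => (integrableOn_Ioi_rpow_mul_exp_neg _ hc).const_mul _
  have hexp : Set.EqOn (fun t => w' t * Q t) (fun t =>
      ∑ m ∈ Finset.range (n + 2), ∑ i ∈ Finset.range (n + 1),
        2 * ((n.choose i : ℝ) * ((-1) ^ i * (((n + 2 : ℕ) : ℝ) - 1) / (m.factorial : ℝ)) *
          x ^ (i + 1)) * (t ^ (((m : ℝ) - 2 * (i : ℝ) - 2) - 1) * Real.exp (-t)))
      (Set.Ioi √x) := fun t ht => mul_sum_eq_sum_rpow n x (hc.trans ht)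
  have hint1 : IntegrableOn (fun t => w' t * Q t) (Set.Ioi √x) := by
    refine IntegrableOn.congr_fun ?_ hexp.symm measurableSet_Ioi
    exact integrable_finsetSum _ fun m _ => integrable_finsetSum _ fun i _ => hint m i
  have hI1 : ∫ t in Set.Ioi √x, w' t * Q t = 1 - gammaSum (n + 2) x := by
    rw [setIntegral_congr_fun measurableSet_Ioi hexp, integral_finsetSum _ fun m _ =>
      integrable_finsetSum _ fun i _ => hint m i, gammaSum, sub_sub_cancel, Finset.mul_sum]
    refine Finset.sum_congr rfl fun m _ => ?_
    rw [integral_finsetSum _ fun i _ => hint m i, Finset.mul_sum]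
    refine Finset.sum_congr rfl fun i _ => ?_
    rw [integral_const_mul, upperGamma, Nat.add_sub_cancel]
    ring
  have hint2 : IntegrableOn
      (fun s => Real.exp (-s) * ((s - x / s) ^ (n + 1) / (n + 1).factorial)) (Set.Ioi √x) := by
    refine Integrable.mono' ((integrableOn_Ioi_rpow_mul_exp_neg ((n + 1 : ℕ) : ℝ) hc).div_const
      ((n + 1).factorial : ℝ)) (Measurable.aestronglyMeasurable (by fun_prop)) ?_
    filter_upwards [ae_restrict_mem measurableSet_Ioi] with s hs
    have hs0 : 0 < s := hc.trans hs
    have h1 : x / s ≤ s := by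
      rw [div_le_iff₀ hs0, ← pow_two]
      exact ((Real.sqrt_lt' hs0).1 hs).le
    have h2 : 0 ≤ x / s := by positivity
    have h3 : 0 ≤ s - x / s := by linarith
    rw [Real.norm_of_nonneg (by positivity), Real.rpow_natCast, mul_comm, div_mul_eq_mul_div]
    gcongr
    linarith
  have hderiv : ∀ t ∈ Set.Ioi √x, HasDerivAt (fun t => (1 - x / t ^ 2) ^ (n + 1) * Q t)
      (w' t * Q t - Real.exp (-t) * ((t - x / t) ^ (n + 1) / (n + 1).factorial)) t := by
    intro t ht
    have ht0 : t ≠ 0 := (hc.trans ht).ne'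
    have hw : HasDerivAt (fun t : ℝ => (1 - x / t ^ 2) ^ (n + 1)) (w' t) t := by
      have h1 : HasDerivAt (fun t : ℝ => 1 - x / t ^ 2) (2 * x / t ^ 3) t := by
        refine (((hasDerivAt_const t x).div (hasDerivAt_pow 2 t) (pow_ne_zero 2 ht0)).const_sub
          1).congr_deriv ?_
        field_simp
        ring
      refine (h1.pow (n + 1)).congr_deriv ?_
      simp [hw']
    refine (hw.mul (hasDerivAt_sum_pow_div_factorial_mul_exp_neg (n + 1) t)).congr_deriv ?_
    have h2 : t - x / t = (1 - x / t ^ 2) * t := by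
      field_simp
    rw [h2, mul_pow]
    ring
  have hcont : ContinuousWithinAt (fun t => (1 - x / t ^ 2) ^ (n + 1) * Q t) (Set.Ici √x) √x := by
    refine ContinuousAt.continuousWithinAt ?_
    have : √x ^ 2 ≠ 0 := by positivity
    fun_prop (disch := assumption)
  have hlim : Filter.Tendsto (fun t => (1 - x / t ^ 2) ^ (n + 1) * Q t) Filter.atTop
      (nhds 0) := by
    have h1 : Filter.Tendsto (fun t : ℝ => x / t ^ 2) Filter.atTop (nhds 0) :=
      Filter.Tendsto.const_div_atTop (Filter.tendsto_pow_atTop two_ne_zero) x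
    have h2 := ((tendsto_const_nhds (x := (1 : ℝ))).sub h1).pow (n + 1)
    simpa using h2.mul (tendsto_sum_pow_div_factorial_mul_exp_neg (n + 2))
  -- the product of the two primitives vanishes both at `√x` and at infinity
  have hFTC := integral_Ioi_of_hasDerivAt_of_tendsto hcont hderiv (hint1.sub hint2) hlim
  have h0 : (1 : ℝ) - x / √x ^ 2 = 0 := by
    rw [Real.sq_sqrt hx.le, div_self hx.ne', sub_self]
  rw [integral_sub hint1 hint2, hI1, h0, zero_pow (Nat.succ_ne_zero n), zero_mul, sub_zero] at hFTC
  linarith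

/-- On `(0, ∞)`, `gammaSum` is the distribution function of `|hᵀ w|² ‖h‖²` for every unit vector
`w`. -/
theorem gammaSum_eq_measureReal (n : ℕ) {w : EuclideanSpace ℂ (Fin (n + 2))}
    (hw : ‖w‖ = 1) {x : ℝ} (hx : 0 < x) :
    gammaSum (n + 2) x =
      (stdComplexGaussianVec (n + 2)).real {h | ‖transposeMul h w‖ ^ 2 * ‖h‖ ^ 2 < x} := by
  have hS : MeasurableSet {h : EuclideanSpace ℂ (Fin (n + 2)) |
      x ≤ ‖transposeMul h w‖ ^ 2 * ‖h‖ ^ 2} := by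
    have := measurable_transposeMul w
    exact measurableSet_le measurable_const (by fun_prop)
  have hcompl : {h : EuclideanSpace ℂ (Fin (n + 2)) | ‖transposeMul h w‖ ^ 2 * ‖h‖ ^ 2 < x} =
      {h | x ≤ ‖transposeMul h w‖ ^ 2 * ‖h‖ ^ 2}ᶜ := by
    ext h
    simp
  rw [hcompl, probReal_compl_eq_one_sub hS, gammaSum_eq_one_sub_integral n hx, Measure.real,
    stdComplexGaussianVec_le_transposeMul n hw hx, integral_eq_lintegral_of_nonneg_ae]
  · filter_upwards [ae_restrict_mem measurableSet_Ioi] with s hs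
    have hs0 : 0 < s := (Real.sqrt_nonneg x).trans_lt hs
    have h1 : x / s ≤ s := by
      rw [div_le_iff₀ hs0, ← pow_two]
      exact ((Real.sqrt_lt' hs0).1 hs).le
    have h3 : 0 ≤ s - x / s := by linarith
    simp only [Pi.zero_apply]
    positivity
  · exact Measurable.aestronglyMeasurable (by fun_prop)

/-! ### The signal-to-noise ratio and the conditional outage probability -/

theorem ae_pos_gammaMeasure_nat (n : ℕ) : ∀ᵐ t ∂gammaMeasure (n + 1) 1, 0 < t := by
  rw [gammaMeasure_nat_eq_withDensity]
  exact (withDensity_absolutelyContinuous _ _).ae_le (ae_restrict_mem measurableSet_Ioi)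

theorem ae_ne_zero_stdComplexGaussianVec (n : ℕ) :
    ∀ᵐ h ∂stdComplexGaussianVec (n + 1), h ≠ 0 := by
  have h := (hasLaw_norm_sq_stdComplexGaussianVec n).ae_iff (p := fun t => 0 < t)
    (measurableSet_Ioi (a := (0 : ℝ))).mem
  filter_upwards [h.2 (ae_pos_gammaMeasure_nat n)] with x hx hx0
  simp [hx0] at hx

theorem measurable_transposeMul_userBeam (N : ℕ) :
    Measurable fun p : EuclideanSpace ℂ (Fin N) × EuclideanSpace ℂ (Fin N) =>
      transposeMul p.1 (userBeam p.2) := by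
  unfold transposeMul userBeam
  simp only
  fun_prop

theorem transposeMul_userBeam_self {N : ℕ} (h : EuclideanSpace ℂ (Fin N)) :
    transposeMul h (userBeam h) = ‖h‖ := by
  have h1 : ∀ i, h i * (starRingEnd ℂ (h i) / (‖h‖ : ℂ)) = (‖h i‖ ^ 2 : ℝ) / (‖h‖ : ℂ) := by
    intro i
    rw [← mul_div_assoc, Complex.mul_conj, Complex.normSq_eq_norm_sq]
  simp only [transposeMul, userBeam, h1]
  rw [← Finset.sum_div, ← Complex.ofReal_sum, ← EuclideanSpace.norm_sq_eq, pow_two,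
    Complex.ofReal_mul, mul_self_div_self]

theorem norm_userBeam {N : ℕ} {h : EuclideanSpace ℂ (Fin N)} (hh : h ≠ 0) :
    ‖userBeam h‖ = 1 := by
  have h0 : ‖h‖ ≠ 0 := norm_ne_zero_iff.2 hh
  have h1 : ‖userBeam h‖ ^ 2 = 1 := by
    rw [EuclideanSpace.norm_sq_eq]
    simp only [userBeam, norm_div, RCLike.norm_conj, Complex.norm_real, norm_norm, div_pow]
    rw [← Finset.sum_div, ← EuclideanSpace.norm_sq_eq, div_self (pow_ne_zero 2 h0)]
  exact (pow_eq_one_iff_of_nonneg (norm_nonneg _) two_ne_zero).1 h1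

/-- The signal-to-noise ratio as a function of `y = |h₁ᵀ w|² = ‖h₁‖²`, `z = |h₃|²` and
`x = |h₂ᵀ w|² ‖h₂‖²`. -/
noncomputable def scalarSNR (a b c y z x : ℝ) : ℝ :=
  a * y ^ 2 + b * c * y * z * x / (b * y * z + c * x + 1)

theorem effectiveSNR_userBeam (η τ ρ α d₁ d₂ d₃ : ℝ) {N : ℕ}
    (h₁ h₂ : EuclideanSpace ℂ (Fin N)) (h₃ : ℂ) :
    effectiveSNR η τ ρ α d₁ d₂ d₃ h₁ h₂ h₃ (userBeam h₁) =
      scalarSNR (2 * η * τ * ρ / ((1 - τ) * d₁ ^ (2 * α)))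
        (2 * η * τ * ρ / ((1 - τ) * d₁ ^ α * d₃ ^ α))
        (2 * η * τ * ρ / ((1 - τ) * d₂ ^ (2 * α))) (‖h₁‖ ^ 2) (‖h₃‖ ^ 2)
        (‖transposeMul h₂ (userBeam h₁)‖ ^ 2 * ‖h₂‖ ^ 2) := by
  rw [effectiveSNR, scalarSNR, transposeMul_userBeam_self, Complex.norm_real, norm_norm]
  generalize 1 - τ = T
  congr 1
  · ring
  · congr 1 <;> ring

section Threshold

variable {a b c γ y z x : ℝ}

theorem not_scalarSNR_lt (hb : 0 < b) (hc : 0 < c) (hy : 0 < y) (hz : 0 ≤ z) (hx : 0 ≤ x)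
    (h : γ ≤ a * y ^ 2) : ¬ scalarSNR a b c y z x < γ := by
  rw [scalarSNR, not_lt]
  have : 0 ≤ b * c * y * z * x / (b * y * z + c * x + 1) := by positivity
  linarith

theorem scalarSNR_lt_of_le (hb : 0 < b) (hc : 0 < c) (hy : 0 < y) (hz : 0 ≤ z) (hx : 0 ≤ x)
    (h : a * y ^ 2 < γ) (hz' : b * y * z ≤ γ - a * y ^ 2) : scalarSNR a b c y z x < γ := by
  have hA : 0 ≤ b * y * z := by positivity
  have hX : 0 ≤ c * x := by positivity
  rw [scalarSNR, ← lt_sub_iff_add_lt', div_lt_iff₀ (by positivity)]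
  nlinarith [mul_nonneg (sub_nonneg.2 hz') hX, mul_nonneg (sub_nonneg.2 h.le) hA]

theorem chiArg_eq : chiArg a b c γ y z =
    (b * y * z + 1) * (γ - a * y ^ 2) / (c * (b * y * z - (γ - a * y ^ 2))) := by
  rw [chiArg]
  congr 1
  ring

theorem scalarSNR_lt_iff (hb : 0 < b) (hc : 0 < c) (hy : 0 < y) (hz : 0 ≤ z) (hx : 0 ≤ x)
    (hz' : γ - a * y ^ 2 < b * y * z) :
    scalarSNR a b c y z x < γ ↔ x < chiArg a b c γ y z := by
  have hd : 0 < c * (b * y * z - (γ - a * y ^ 2)) := mul_pos hc (sub_pos.2 hz')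
  rw [scalarSNR, ← lt_sub_iff_add_lt', div_lt_iff₀ (by positivity), chiArg_eq, lt_div_iff₀ hd,
    ← sub_pos, ← sub_pos (b := x * _)]
  ring_nf

theorem chiArg_pos (hb : 0 < b) (hc : 0 < c) (hy : 0 < y) (hz : 0 ≤ z)
    (h : a * y ^ 2 < γ) (hz' : γ - a * y ^ 2 < b * y * z) : 0 < chiArg a b c γ y z := by
  rw [chiArg_eq]
  have h1 := sub_pos.2 h
  have h2 := sub_pos.2 hz'
  positivity

end Threshold

/-- The distribution function `P(|h₂ᵀ w|² ‖h₂‖² < x)`, where the unit vector `w` is taken to be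
the first basis vector. -/
noncomputable def beamGainCDF (n : ℕ) (x : ℝ) : ℝ :=
  (stdComplexGaussianVec (n + 2)).real
    {h | ‖transposeMul h (EuclideanSpace.single 0 1)‖ ^ 2 * ‖h‖ ^ 2 < x}

theorem measurable_beamGainCDF (n : ℕ) : Measurable (beamGainCDF n) := by
  refine Monotone.measurable fun x y hxy => ?_
  exact measureReal_mono fun h hh => lt_of_lt_of_le hh hxy

theorem gammaSum_eq_beamGainCDF (n : ℕ) {x : ℝ} (hx : 0 < x) :
    gammaSum (n + 2) x = beamGainCDF n x :=
  gammaSum_eq_measureReal n (by simp) hx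

/-- The conditional outage probability given `‖h₁‖² = y` and `|h₃|² = z`, as a function of the pair
`(y, z)`. -/
noncomputable def condOutage (n : ℕ) (a b c γ : ℝ) (p : ℝ × ℝ) : ℝ :=
  if γ ≤ a * p.1 ^ 2 then 0
  else if b * p.1 * p.2 ≤ γ - a * p.1 ^ 2 then 1
  else beamGainCDF n (chiArg a b c γ p.1 p.2)

/-- Measurability holds on the whole plane because the last branch is written with `beamGainCDF`,
which is monotone on `ℝ`; `gammaSum` agrees with it only on `(0, ∞)`. -/
theorem measurable_condOutage (n : ℕ) (a b c γ : ℝ) : Measurable (condOutage n a b c γ) := by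
  have hchi : Measurable fun p : ℝ × ℝ => chiArg a b c γ p.1 p.2 := by
    unfold chiArg
    fun_prop
  refine Measurable.ite (measurableSet_le (by fun_prop) (by fun_prop)) (by fun_prop) ?_
  exact Measurable.ite (measurableSet_le (by fun_prop) (by fun_prop)) (by fun_prop)
    ((measurable_beamGainCDF n).comp hchi)

theorem condOutage_nonneg (n : ℕ) (a b c γ : ℝ) (p : ℝ × ℝ) : 0 ≤ condOutage n a b c γ p := by
  unfold condOutage
  split_ifs
  exacts [le_rfl, zero_le_one, measureReal_nonneg]

theorem condOutage_le_one (n : ℕ) (a b c γ : ℝ) (p : ℝ × ℝ) : condOutage n a b c γ p ≤ 1 := by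
  unfold condOutage
  split_ifs
  exacts [zero_le_one, le_rfl, measureReal_le_one]

theorem integrable_condOutage (n : ℕ) (a b c γ : ℝ) (μ : Measure (ℝ × ℝ)) [IsFiniteMeasure μ] :
    Integrable (condOutage n a b c γ) μ :=
  Integrable.of_bound (measurable_condOutage n a b c γ).aestronglyMeasurable 1 <|
    ae_of_all _ fun p => by
      rw [Real.norm_of_nonneg (condOutage_nonneg n a b c γ p)]
      exact condOutage_le_one n a b c γ p

theorem measure_scalarSNR_lt (n : ℕ) {a b c γ y z : ℝ} (hb : 0 < b) (hc : 0 < c) (hy : 0 < y)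
    (hz : 0 ≤ z) {w : EuclideanSpace ℂ (Fin (n + 2))} (hw : ‖w‖ = 1) :
    stdComplexGaussianVec (n + 2)
        {h | scalarSNR a b c y z (‖transposeMul h w‖ ^ 2 * ‖h‖ ^ 2) < γ} =
      ENNReal.ofReal (condOutage n a b c γ (y, z)) := by
  have hx : ∀ h : EuclideanSpace ℂ (Fin (n + 2)), 0 ≤ ‖transposeMul h w‖ ^ 2 * ‖h‖ ^ 2 :=
    fun h => by positivity
  unfold condOutage
  simp only
  split_ifs with h1 h2
  · simp only [not_scalarSNR_lt hb hc hy hz (hx _) h1]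
    simp
  · simp only [scalarSNR_lt_of_le hb hc hy hz (hx _) (not_le.1 h1) h2]
    simp
  · simp only [scalarSNR_lt_iff hb hc hy hz (hx _) (not_le.1 h2)]
    rw [← gammaSum_eq_beamGainCDF n (chiArg_pos hb hc hy hz (not_le.1 h1) (not_le.1 h2)),
      gammaSum_eq_measureReal n hw (chiArg_pos hb hc hy hz (not_le.1 h1) (not_le.1 h2)),
      ofReal_measureReal]

/-- The joint law of the three channels is a product law. -/
theorem RayleighFading.hasLaw {Ω : Type*} [MeasurableSpace Ω] {P : Measure Ω} {N : ℕ}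
    {h₁ h₂ : Ω → EuclideanSpace ℂ (Fin N)} {h₃ : Ω → ℂ} (hf : RayleighFading P h₁ h₂ h₃) :
    HasLaw (fun ω => (h₁ ω, h₂ ω, h₃ ω))
      ((stdComplexGaussianVec N).prod ((stdComplexGaussianVec N).prod stdComplexGaussian)) P := by
  have hlaw : ∀ i, HasLaw ((Sum.elim (fun i ω => h₁ ω i) (Sum.elim (fun i ω => h₂ ω i)
      (fun _ ω => h₃ ω)) : Fin N ⊕ Fin N ⊕ Unit → Ω → ℂ) i) stdComplexGaussian P := by
    rintro (i | i | i)
    exacts [hf.law₁ i, hf.law₂ i, hf.law₃]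
  have hpi := hf.indep.hasLaw_pi hlaw
  have hm1 := measurePreserving_sumPiEquivProdPi
    (fun _ : Fin N ⊕ Fin N ⊕ Unit => stdComplexGaussian)
  have hm2 := measurePreserving_sumPiEquivProdPi (fun _ : Fin N ⊕ Unit => stdComplexGaussian)
  have hm3 := measurePreserving_funUnique stdComplexGaussian Unit
  have hL : MeasurePreserving (WithLp.toLp 2)
      (Measure.pi fun _ : Fin N => stdComplexGaussian) (stdComplexGaussianVec N) :=
    ⟨by fun_prop, rfl⟩
  have := ((hL.prod ((hL.prod hm3).comp hm2)).comp hm1).comp_hasLaw hpi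
  exact this

/-! ### Averaging over `‖h₁‖²` and `|h₃|²` -/

/-- The outage probability is the mean of the conditional outage probability. -/
theorem RayleighFading.measureReal_effectiveSNR_lt {Ω : Type*} [MeasurableSpace Ω] {P : Measure Ω}
    {n : ℕ} {h₁ h₂ : Ω → EuclideanSpace ℂ (Fin (n + 2))} {h₃ : Ω → ℂ}
    (hf : RayleighFading P h₁ h₂ h₃) (η τ ρ α d₁ d₂ d₃ γ : ℝ) {a b c : ℝ}
    (ha : a = 2 * η * τ * ρ / ((1 - τ) * d₁ ^ (2 * α)))
    (hb : b = 2 * η * τ * ρ / ((1 - τ) * d₁ ^ α * d₃ ^ α))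
    (hc : c = 2 * η * τ * ρ / ((1 - τ) * d₂ ^ (2 * α))) (hb0 : 0 < b) (hc0 : 0 < c) :
    P.real {ω | effectiveSNR η τ ρ α d₁ d₂ d₃ (h₁ ω) (h₂ ω) (h₃ ω) (userBeam (h₁ ω)) < γ} =
      ∫ y, ∫ z, condOutage n a b c γ (y, z) ∂gammaMeasure 1 1
        ∂gammaMeasure ((n + 1 : ℕ) + 1) 1 := by
  simp only [effectiveSNR_userBeam, ← ha, ← hb, ← hc]
  have hK := measurable_condOutage n a b c γ
  have hKE : Measurable fun p => ENNReal.ofReal (condOutage n a b c γ p) := hK.ennreal_ofReal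
  let p : EuclideanSpace ℂ (Fin (n + 2)) × EuclideanSpace ℂ (Fin (n + 2)) × ℂ → Prop := fun q =>
    scalarSNR a b c (‖q.1‖ ^ 2) (‖q.2.2‖ ^ 2)
      (‖transposeMul q.2.1 (userBeam q.1)‖ ^ 2 * ‖q.2.1‖ ^ 2) < γ
  have hp : MeasurableSet {q | p q} := by
    have h1 : Measurable fun q : EuclideanSpace ℂ (Fin (n + 2)) ×
        EuclideanSpace ℂ (Fin (n + 2)) × ℂ => transposeMul q.2.1 (userBeam q.1) :=
      (measurable_transposeMul_userBeam (n + 2)).comp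
        ((measurable_fst.comp measurable_snd).prodMk measurable_fst)
    refine measurableSet_lt ?_ measurable_const
    unfold scalarSNR
    fun_prop
  -- `h₁ = 0` has to be excluded: the beam is then the zero vector, not a unit vector
  have hinner : ∀ᵐ g ∂stdComplexGaussianVec (n + 2),
      ((stdComplexGaussianVec (n + 2)).prod stdComplexGaussian) (Prod.mk g ⁻¹' {q | p q}) =
        ∫⁻ z, ENNReal.ofReal (condOutage n a b c γ (‖g‖ ^ 2, z)) ∂gammaMeasure 1 1 := by
    filter_upwards [ae_ne_zero_stdComplexGaussianVec (n + 1)] with g hg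
    rw [Measure.prod_apply_symm (measurable_prodMk_left hp),
      ← hasLaw_norm_sq_stdComplexGaussian.lintegral_comp (by fun_prop)]
    refine lintegral_congr fun z => ?_
    have h1 := measure_scalarSNR_lt (a := a) (γ := γ) n hb0 hc0 (pow_pos (norm_pos_iff.2 hg) 2)
      (sq_nonneg ‖z‖) (norm_userBeam hg)
    rw [← h1]
    rfl
  have hmain : P {ω | p (h₁ ω, h₂ ω, h₃ ω)} =
      ∫⁻ q, ENNReal.ofReal (condOutage n a b c γ q)
        ∂(gammaMeasure ((n + 1 : ℕ) + 1) 1).prod (gammaMeasure 1 1) := by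
    rw [hf.hasLaw.measure_eq hp, Measure.prod_apply hp, lintegral_congr_ae hinner,
      lintegral_prod _ hKE.aemeasurable]
    refine (hasLaw_norm_sq_stdComplexGaussianVec (n + 1)).lintegral_comp
      (f := fun y => ∫⁻ z, ENNReal.ofReal (condOutage n a b c γ (y, z)) ∂gammaMeasure 1 1) ?_
    exact hKE.lintegral_prod_right'.aemeasurable
  have hint := integrable_condOutage n a b c γ
    ((gammaMeasure ((n + 1 : ℕ) + 1) 1).prod (gammaMeasure 1 1))
  change (P {ω | p (h₁ ω, h₂ ω, h₃ ω)}).toReal = _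
  rw [hmain, ← integral_prod _ hint, integral_eq_lintegral_of_nonneg_ae
    (ae_of_all _ fun q => condOutage_nonneg n a b c γ q) hint.aestronglyMeasurable]

theorem integral_gammaMeasure_one (f : ℝ → ℝ) :
    ∫ t, f t ∂gammaMeasure 1 1 = ∫ t in Set.Ioi 0, Real.exp (-t) * f t := by
  simpa using integral_gammaMeasure_nat 0 f

theorem integrable_gammaMeasure_one_iff (f : ℝ → ℝ) :
    Integrable f (gammaMeasure 1 1) ↔
      IntegrableOn (fun t => Real.exp (-t) * f t) (Set.Ioi 0) := by
  simpa using integrable_gammaMeasure_nat_iff 0 f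

section Slice

variable {a b c γ y : ℝ}

theorem mul_sq_lt_of_lt_sqrt (ha : 0 < a) (hy : y ∈ Set.Ioo 0 √(γ / a)) : a * y ^ 2 < γ := by
  have := (Real.lt_sqrt hy.1.le).1 hy.2
  rwa [lt_div_iff₀ ha, mul_comm] at this

theorem integrable_condOutage_slice (n : ℕ) (a b c γ y : ℝ) :
    Integrable (fun z => condOutage n a b c γ (y, z)) (gammaMeasure 1 1) :=
  Integrable.of_bound ((measurable_condOutage n a b c γ).comp
    measurable_prodMk_left).aestronglyMeasurable 1 <| ae_of_all _ fun z => by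
      rw [Real.norm_of_nonneg (condOutage_nonneg n a b c γ (y, z))]
      exact condOutage_le_one n a b c γ (y, z)

theorem eqOn_exp_mul_condOutage (n : ℕ) (hb : 0 < b) (hc : 0 < c) (hy : 0 < y)
    (h : a * y ^ 2 < γ) :
    Set.EqOn (fun z => Real.exp (-z) * condOutage n a b c γ (y, z))
      (innerIntegrand (n + 2) a b c γ y) (Set.Ioi ((γ - a * y ^ 2) / (b * y))) := by
  intro z hz
  have hby : 0 < b * y := by positivity
  have hz' : γ - a * y ^ 2 < b * y * z := (div_lt_iff₀' hby).1 hz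
  have hz0 : 0 ≤ z := by
    have := div_pos (sub_pos.2 h) hby
    exact (this.trans hz).le
  simp only [condOutage, innerIntegrand]
  rw [if_neg (not_le.2 h), if_neg (not_le.2 hz'),
    gammaSum_eq_beamGainCDF n (chiArg_pos hb hc hy hz0 h hz'), mul_comm]

theorem integrableOn_innerIntegrand (n : ℕ) (hb : 0 < b) (hc : 0 < c) (hy : 0 < y)
    (h : a * y ^ 2 < γ) :
    IntegrableOn (innerIntegrand (n + 2) a b c γ y)
      (Set.Ioi ((γ - a * y ^ 2) / (b * y))) := by
  have h1 := (integrable_gammaMeasure_one_iff _).1 (integrable_condOutage_slice n a b c γ y)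
  have h2 : 0 < (γ - a * y ^ 2) / (b * y) := div_pos (sub_pos.2 h) (by positivity)
  exact (h1.mono_set (Set.Ioi_subset_Ioi h2.le)).congr_fun
    (eqOn_exp_mul_condOutage n hb hc hy h) measurableSet_Ioi

/-- The range `z ≤ (γ - a y²) / (b y)`, in which outage is certain, contributes the first summand. -/
theorem integral_condOutage_slice (n : ℕ) (hb : 0 < b) (hc : 0 < c) (hy : 0 < y)
    (h : a * y ^ 2 < γ) :
    ∫ z, condOutage n a b c γ (y, z) ∂gammaMeasure 1 1 =
      (1 - Real.exp (a / b * y - γ / (b * y))) +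
        ∫ z in Set.Ioi ((γ - a * y ^ 2) / (b * y)), innerIntegrand (n + 2) a b c γ y z := by
  have h1 := (integrable_gammaMeasure_one_iff _).1 (integrable_condOutage_slice n a b c γ y)
  have hby : 0 < b * y := by positivity
  set q := (γ - a * y ^ 2) / (b * y) with hq
  have hq0 : 0 < q := div_pos (sub_pos.2 h) hby
  have h2 : Set.EqOn (fun z => Real.exp (-z) * condOutage n a b c γ (y, z))
      (fun z => Real.exp (-z)) (Set.Ioc 0 q) := by
    intro z hz
    have hz' : b * y * z ≤ γ - a * y ^ 2 := (le_div_iff₀' hby).1 hz.2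
    simp only [condOutage]
    rw [if_neg (not_le.2 h), if_pos hz', mul_one]
  have h3 : ∫ z in Set.Ioc 0 q, Real.exp (-z) = 1 - Real.exp (-q) := by
    rw [← intervalIntegral.integral_of_le hq0.le, intervalIntegral.integral_comp_neg, integral_exp]
    simp
  have h4 : -q = a / b * y - γ / (b * y) := by
    rw [hq]
    field_simp
    ring
  rw [integral_gammaMeasure_one, ← Set.Ioc_union_Ioi_eq_Ioi hq0.le,
    setIntegral_union (Set.Ioc_disjoint_Ioi le_rfl) measurableSet_Ioi
      (h1.mono_set Set.Ioc_subset_Ioi_self) (h1.mono_set (Set.Ioi_subset_Ioi hq0.le)),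
    setIntegral_congr_fun measurableSet_Ioc h2,
    setIntegral_congr_fun measurableSet_Ioi (eqOn_exp_mul_condOutage n hb hc hy h), h3, h4]

theorem integral_condOutage_slice_eq_zero (n : ℕ) (h : γ ≤ a * y ^ 2) :
    ∫ z, condOutage n a b c γ (y, z) ∂gammaMeasure 1 1 = 0 := by
  simp [condOutage, h]

theorem eqOn_density_mul_integral_condOutage (n : ℕ) (ha : 0 < a) (hb : 0 < b) (hc : 0 < c) :
    Set.EqOn
      (fun y => y ^ (n + 1) / (n + 1).factorial * Real.exp (-y) *
        ∫ z, condOutage n a b c γ (y, z) ∂gammaMeasure 1 1)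
      (fun y => singleIntegrand (n + 2) a b γ y + outerIntegrand (n + 2) a b c γ y)
      (Set.Ioo 0 √(γ / a)) := by
  intro y hy
  have hG : Real.Gamma ((n + 2 : ℕ) : ℝ) = (n + 1).factorial := by
    rw [show ((n + 2 : ℕ) : ℝ) = ((n + 1 : ℕ) : ℝ) + 1 by push_cast; ring,
      Real.Gamma_nat_eq_factorial]
  simp only
  rw [integral_condOutage_slice n hb hc hy.1 (mul_sq_lt_of_lt_sqrt ha hy), singleIntegrand,
    outerIntegrand, hG, show n + 2 - 1 = n + 1 from rfl]
  ring

theorem integrableOn_singleIntegrand (n : ℕ) (ha : 0 < a) (hb : 0 < b) :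
    IntegrableOn (singleIntegrand (n + 2) a b γ) (Set.Ioo 0 √(γ / a)) := by
  have hcont : IntegrableOn
      (fun y => y ^ (n + 2 - 1) / Real.Gamma ((n + 2 : ℕ) : ℝ) * Real.exp (-y))
      (Set.Ioo 0 √(γ / a)) :=
    (Continuous.integrableOn_Icc (by fun_prop)).mono_set Set.Ioo_subset_Icc_self
  refine Integrable.mono' hcont ?_ ?_
  · unfold singleIntegrand
    exact Measurable.aestronglyMeasurable (by fun_prop)
  · filter_upwards [ae_restrict_mem measurableSet_Ioo] with y hy
    have hy0 := hy.1
    have hG : 0 < Real.Gamma ((n + 2 : ℕ) : ℝ) := Real.Gamma_pos_of_pos (by positivity)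
    have h0 : a / b * y - γ / (b * y) ≤ 0 := by
      have h1 := mul_sq_lt_of_lt_sqrt ha hy
      rw [show a / b * y - γ / (b * y) = -((γ - a * y ^ 2) / (b * y)) by field_simp; ring]
      have := div_pos (sub_pos.2 h1) (mul_pos hb hy0)
      linarith
    have h2 := Real.exp_le_one_iff.2 h0
    have h3 := Real.exp_pos (a / b * y - γ / (b * y))
    rw [singleIntegrand, norm_mul, norm_mul, Real.norm_of_nonneg (sub_nonneg.2 h2),
      Real.norm_of_nonneg (by positivity), Real.norm_of_nonneg (by positivity), mul_assoc]
    exact mul_le_of_le_one_left (by positivity) (by linarith)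

theorem integrableOn_density_mul_integral_condOutage (n : ℕ) (a b c γ : ℝ) :
    IntegrableOn (fun y => y ^ (n + 1) / (n + 1).factorial * Real.exp (-y) *
        ∫ z, condOutage n a b c γ (y, z) ∂gammaMeasure 1 1) (Set.Ioi 0) :=
  (integrable_gammaMeasure_nat_iff (n + 1) _).1
    (integrable_condOutage n a b c γ _).integral_prod_left

/-- The outer integrand is the difference of two integrable functions, so that the measurability of
its inner integral need not be examined. -/
theorem integrableOn_outerIntegrand (n : ℕ) (ha : 0 < a) (hb : 0 < b) (hc : 0 < c) :
    IntegrableOn (outerIntegrand (n + 2) a b c γ) (Set.Ioo 0 √(γ / a)) := by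
  have h1 := ((integrableOn_density_mul_integral_condOutage n a b c γ).mono_set
    Set.Ioo_subset_Ioi_self).congr_fun
    (eqOn_density_mul_integral_condOutage n ha hb hc) measurableSet_Ioo
  refine (h1.sub (integrableOn_singleIntegrand n ha hb)).congr (ae_of_all _ fun y => ?_)
  simp

end Slice

theorem theorem4 {Ω : Type*} [MeasurableSpace Ω] (P : Measure Ω) [IsProbabilityMeasure P]
    (N : ℕ) (hN : 2 ≤ N)
    (η τ ρ α d₁ d₂ d₃ γth : ℝ) (hη : 0 < η) (hτ₀ : 0 < τ) (hτ₁ : τ < 1) (hρ : 0 < ρ)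
    (hd₁ : 0 < d₁) (hd₂ : 0 < d₂) (hd₃ : 0 < d₃) (hγ : 0 < γth)
    (a₁ b₁ c₁ : ℝ)
    (ha₁ : a₁ = 2 * η * τ * ρ / ((1 - τ) * d₁ ^ (2 * α)))
    (hb₁ : b₁ = 2 * η * τ * ρ / ((1 - τ) * d₁ ^ α * d₃ ^ α))
    (hc₁ : c₁ = 2 * η * τ * ρ / ((1 - τ) * d₂ ^ (2 * α)))
    (h₁ h₂ : Ω → EuclideanSpace ℂ (Fin N)) (h₃ : Ω → ℂ)
    (hfading : RayleighFading P h₁ h₂ h₃) :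
    IntervalIntegrable (singleIntegrand N a₁ b₁ γth) volume 0 (Real.sqrt (γth / a₁)) ∧
    (∀ y ∈ Set.Ioo 0 (Real.sqrt (γth / a₁)),
      IntegrableOn (innerIntegrand N a₁ b₁ c₁ γth y)
        (Set.Ioi ((γth - a₁ * y ^ 2) / (b₁ * y))) volume) ∧
    IntervalIntegrable (outerIntegrand N a₁ b₁ c₁ γth) volume 0 (Real.sqrt (γth / a₁)) ∧
    P.real {ω | effectiveSNR η τ ρ α d₁ d₂ d₃ (h₁ ω) (h₂ ω) (h₃ ω) (userBeam (h₁ ω)) < γth} =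
      (∫ y in (0 : ℝ)..Real.sqrt (γth / a₁), singleIntegrand N a₁ b₁ γth y) +
        ∫ y in (0 : ℝ)..Real.sqrt (γth / a₁), outerIntegrand N a₁ b₁ c₁ γth y := by
  obtain ⟨n, rfl⟩ : ∃ n, N = n + 2 := ⟨N - 2, by omega⟩
  have hτ : 0 < 1 - τ := sub_pos.2 hτ₁
  have ha : 0 < a₁ := by rw [ha₁]; positivity
  have hb : 0 < b₁ := by rw [hb₁]; positivity
  have hc : 0 < c₁ := by rw [hc₁]; positivity
  have hR : 0 ≤ √(γth / a₁) := Real.sqrt_nonneg _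
  have hS := integrableOn_singleIntegrand (γ := γth) n ha hb
  have hO := integrableOn_outerIntegrand (γ := γth) n ha hb hc
  refine ⟨(intervalIntegrable_iff_integrableOn_Ioo_of_le hR).2 hS, fun y hy =>
    integrableOn_innerIntegrand n hb hc hy.1 (mul_sq_lt_of_lt_sqrt ha hy),
    (intervalIntegrable_iff_integrableOn_Ioo_of_le hR).2 hO, ?_⟩
  rw [hfading.measureReal_effectiveSNR_lt η τ ρ α d₁ d₂ d₃ γth ha₁ hb₁ hc₁ hb hc,
    integral_gammaMeasure_nat, intervalIntegral.integral_of_le hR,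
    intervalIntegral.integral_of_le hR, integral_Ioc_eq_integral_Ioo,
    integral_Ioc_eq_integral_Ioo, ← integral_add hS hO,
    ← setIntegral_congr_fun measurableSet_Ioo (eqOn_density_mul_integral_condOutage n ha hb hc)]
  refine setIntegral_eq_of_subset_of_forall_sdiff_eq_zero measurableSet_Ioi
    Set.Ioo_subset_Ioi_self fun y hy => ?_
  -- beyond the upper limit the direct link alone exceeds the threshold
  have hy0 : 0 < y := hy.1
  have hyR : √(γth / a₁) ≤ y := not_lt.1 fun h => hy.2 ⟨hy0, h⟩
  have hle : γth ≤ a₁ * y ^ 2 := by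
    rw [← div_le_iff₀' ha]
    exact (Real.sqrt_le_left hy0.le).1 hyR
  rw [integral_condOutage_slice_eq_zero n hle, mul_zero]
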